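/- Let $k$ be a commutative ring with identity; all algebras are commutative $k$-algebras with identity. A unital partial action $\alpha_G=(S_g,\alpha_g)_{g\in G}$ of a group $G$ on an algebra $S$ consists of ideals $S_g=S1_g$ generated by idempotents $1_g\in S$ and $k$-algebra isomorphisms $\alpha_g:S_{g^{-1}}\to S_g$ such that $S_1=S$, $\alpha_1=\mathrm{id}_S$, $\alpha_g(S_{g^{-1}}\cap S_h)=S_g\cap S_{gh}$, and $\alpha_g(\alpha_h(x))=\alpha_{gh}(x)$ for all $x\in S_{h^{-1}}$ with $\alpha_h(x)\in S_{g^{-1}}$. Put $S^{\alpha_G}=\{s\in S:\alpha_g(s1_{g^{-1}})=s1_g\text{ for all }g\in G\}$, and for a subgroup $H$ of $G$ let $\alpha_H=(S_h,\alpha_h)_{h\in H}$. For $G$ finite, $S$ is a partial $\alpha_G$-Galois extension of an algebra $R$ if $R\simeq S^{\alpha_G}$ as $k$-algebras and there are $m\in\mathbb N$ and $x_i,y_i\in S$ $(1\le i\le m)$ with $\sum_{i=1}^m x_i\alpha_g(y_i1_{g^{-1}})=\delta_{1,g}$ for every $g\in G$. A globalization of $\alpha_G$ is an algebra $T$ with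 an action $\beta$ of $G$ by $k$-algebra automorphisms which contains $S$ as an ideal (with the inclusion $k$-linear and multiplicative, but not necessarily preserving the identity), such that $S_g=S\cap\beta_g(S)$, $\beta_g|_{S_{g^{-1}}}=\alpha_g$ for all $g\in G$, and $T=\sum_{g\in G}\beta_g(S)$. For a subgroup $H=\{h_1=1,h_2,\dots,h_m\}$ of $G$ define $\psi_H:T\to T$ and $e_H\in T$ by $$\psi_H(t)=\sum_{i=1}^m\beta_{h_i}(t)\Big(\prod_{j<i}\big(1_T-\beta_{h_j}(1_S)\big)\Big)\beta_{h_i}(1_S),\qquad e_H=\psi_H(1_S).$$ **Theorem.** Let $G$ be a finite group, $\alpha_G$ a unital partial action of $G$ on an algebra $S$ such that $S$ is a partial $\alpha_G$-Galois extension of $S^{\alpha_G}$, and let $H$ be a normal subgroup of $G$. Then $\alpha_G$ induces a unital partial action $\alpha_{G/H}=(\tilde D_{gH},\alpha_{gH})_{gH\in G/H}$ of $G/H$ on $S^{\alpha_H}$; that is, a globalization $(T,\beta)$ of $\alpha_G$ exists, and there is a unital partial action $\alpha_{G/H}$ of $G/H$ on $S^{\alpha_H}$ such that, for every globalization $(T,\beta)$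 of $\alpha_G$, every enumeration of $H$ starting with $1$ and every $g\in G$, $$\tilde D_{gH}=S^{\alpha_H}\tilde 1_{gH},\quad \tilde 1_{gH}=\beta_g(e_H)1_S,\qquad \alpha_{gH}(x)=\beta_g(\psi_H(x))1_S\ \text{ for } x\in\tilde D_{g^{-1}H}.$$ Moreover, $S^{\alpha_H}$ is a partial $\alpha_{G/H}$-Galois extension of $S^{\alpha_G}$, and $(S^{\alpha_H})^{\alpha_{G/H}}=S^{\alpha_G}$. -/

import Mathlib

universe u v w

/-- A partial action of a group `G` on a commutative `k`-algebra `S`: ideals `S_g` of `S` and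
`k`-algebra isomorphisms `α_g : S_{g⁻¹} → S_g` (bijective, `k`-linear and multiplicative; the
ideals need not contain the identity element of `S`). -/
structure PartialAction (k : Type u) (G : Type w) (S : Type v)
    [CommRing k] [Group G] [CommRing S] [Algebra k S] where
  /-- the ideal `S_g` -/
  dom : G → Ideal S
  /-- the isomorphism `α_g : S_{g⁻¹} → S_g` -/
  iso : ∀ g : G, dom g⁻¹ ≃ₗ[k] dom g
  iso_mul : ∀ (g : G) (x y : dom g⁻¹),
    (iso g ⟨(x : S) * (y : S), Ideal.mul_mem_right _ _ x.2⟩ : S) = (iso g x : S) * (iso g y : S)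
  dom_one : dom 1 = ⊤
  iso_one : ∀ x : dom (1 : G)⁻¹, (iso 1 x : S) = (x : S)
  /-- `α_g (S_{g⁻¹} ∩ S_h) = S_g ∩ S_{gh}` -/
  image_inter : ∀ g h : G,
    (fun x : dom g⁻¹ => (iso g x : S)) '' {x | (x : S) ∈ dom h} = {y | y ∈ dom g ∧ y ∈ dom (g * h)}
  /-- `α_g (α_h x) = α_{gh} x` whenever the left-hand side makes sense, that is, for `x ∈ S_{h⁻¹}`
  with `α_h x ∈ S_{g⁻¹}` -/
  comp : ∀ (g h : G) (x : dom h⁻¹) (hx : (iso h x : S) ∈ dom g⁻¹),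
    ∃ hx' : (x : S) ∈ dom (g * h)⁻¹, (iso g ⟨iso h x, hx⟩ : S) = (iso (g * h) ⟨x, hx'⟩ : S)

/-- A unital partial action: each ideal `S_g` is generated by an idempotent `1_g` (which is
unique, being the identity element of `S_g`). -/
structure UnitalPartialAction (k : Type u) (G : Type w) (S : Type v)
    [CommRing k] [Group G] [CommRing S] [Algebra k S] extends PartialAction k G S where
  /-- the idempotent `1_g` -/
  e : G → S
  e_idem : ∀ g, IsIdempotentElem (e g)
  dom_eq : ∀ g, dom g = Ideal.span {e g}

namespace UnitalPartialAction

variable {k : Type u} {G : Type w} {S : Type v}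
  [CommRing k] [Group G] [CommRing S] [Algebra k S]

theorem mul_e_mem (α : UnitalPartialAction k G S) (g : G) (s : S) : s * α.e g ∈ α.dom g := by
  rw [α.dom_eq]
  exact Ideal.mul_mem_left _ _ (Ideal.mem_span_singleton_self _)

theorem mul_e_of_mem (α : UnitalPartialAction k G S) {g : G} {s : S} (hs : s ∈ α.dom g) :
    s * α.e g = s := by
  rw [α.dom_eq, Ideal.mem_span_singleton'] at hs
  obtain ⟨a, rfl⟩ := hs
  rw [mul_assoc, (α.e_idem g).eq]

/-- The element `α_g (s 1_{g⁻¹})` of `S`. -/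
def act (α : UnitalPartialAction k G S) (g : G) (s : S) : S :=
  (α.iso g ⟨s * α.e g⁻¹, α.mul_e_mem g⁻¹ s⟩ : S)

theorem act_add (α : UnitalPartialAction k G S) (g : G) (s t : S) :
    α.act g (s + t) = α.act g s + α.act g t := by
  unfold act
  rw [← Submodule.coe_add, ← map_add]
  congr 2
  exact Subtype.ext (add_mul _ _ _)

theorem act_mul (α : UnitalPartialAction k G S) (g : G) (s t : S) :
    α.act g (s * t) = α.act g s * α.act g t := by
  unfold act
  rw [← α.iso_mul]
  congr 2
  apply Subtype.ext
  change s * t * α.e g⁻¹ = s * α.e g⁻¹ * (t * α.e g⁻¹)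
  rw [mul_mul_mul_comm, (α.e_idem g⁻¹).eq]

theorem act_smul (α : UnitalPartialAction k G S) (g : G) (r : k) (s : S) :
    α.act g (r • s) = r • α.act g s := by
  unfold act
  rw [← Submodule.coe_smul_of_tower, ← map_smul]
  congr 2
  exact Subtype.ext (smul_mul_assoc _ _ _)

theorem act_one (α : UnitalPartialAction k G S) (g : G) : α.act g 1 = α.e g := by
  obtain ⟨x, hx⟩ := (α.iso g).surjective ⟨α.e g, by simpa using α.mul_e_mem g 1⟩
  have h1 : α.act g (x : S) = α.e g := by
    unfold act
    have : (⟨(x : S) * α.e g⁻¹, α.mul_e_mem g⁻¹ x⟩ : α.dom g⁻¹) = x :=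
      Subtype.ext (α.mul_e_of_mem x.2)
    rw [this, hx]
  have h2 : α.act g 1 * α.e g = α.act g 1 := α.mul_e_of_mem (Subtype.property _)
  rw [← h2]
  conv_lhs => rw [← h1]
  rw [← act_mul, one_mul, h1]

/-- The subalgebra of invariants `S^α = {s ∈ S | α_g (s 1_{g⁻¹}) = s 1_g for all g}`. -/
def invariants (α : UnitalPartialAction k G S) : Subalgebra k S where
  carrier := {s | ∀ g : G, α.act g s = s * α.e g}
  mul_mem' := by
    intro s t hs ht g
    rw [act_mul, hs g, ht g, mul_mul_mul_comm, (α.e_idem g).eq]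
  add_mem' := by
    intro s t hs ht g
    rw [act_add, hs g, ht g, add_mul]
  algebraMap_mem' := by
    intro r g
    rw [Algebra.algebraMap_eq_smul_one, act_smul, act_one, smul_mul_assoc, one_mul]

/-- The restriction of a unital partial action of `G` to a subgroup `H`. -/
def restrict (α : UnitalPartialAction k G S) (H : Subgroup G) : UnitalPartialAction k H S where
  dom h := α.dom (h : G)
  iso h := α.iso (h : G)
  iso_mul h := α.iso_mul (h : G)
  dom_one := α.dom_one
  iso_one := α.iso_one
  image_inter g h := α.image_inter (g : G) (h : G)
  comp g h := α.comp (g : G) (h : G)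
  e h := α.e (h : G)
  e_idem h := α.e_idem (h : G)
  dom_eq h := α.dom_eq (h : G)

open Classical in
/-- `S` is a partial `α`-Galois extension of the `k`-algebra `R`: `R ≃ S^α` as `k`-algebras, and
there are partial Galois coordinates `x_i, y_i ∈ S` with
`∑ i, x_i α_g (y_i 1_{g⁻¹}) = δ_{1,g}` for all `g`. -/
def IsPartialGaloisExtension (α : UnitalPartialAction k G S)
    (R : Type*) [CommRing R] [Algebra k R] : Prop :=
  Nonempty (R ≃ₐ[k] α.invariants) ∧
  ∃ (m : ℕ) (x y : Fin m → S), ∀ g : G,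
    ∑ i, x i * α.act g (y i) = if g = 1 then 1 else 0

/-- A globalization of `α`: a commutative `k`-algebra `T` with a (global) action `β` of `G` by
`k`-algebra automorphisms and a monomorphism `φ : S → T` onto an ideal of `T` (not necessarily
preserving the identity element), such that `α` is the restriction of `β` to `φ(S)` and `T` is the
sum of the `β_g (φ(S))`. -/
structure Globalization (α : UnitalPartialAction k G S)
    (T : Type*) [CommRing T] [Algebra k T] where
  β : G →* (T ≃ₐ[k] T)
  φ : S →ₙₐ[k] T
  φ_injective : Function.Injective φ
  range_ideal : ∀ (t : T) (s : S), ∃ s' : S, φ s' = t * φ s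
  image_dom : ∀ g : G, φ '' (α.dom g : Set S) = Set.range φ ∩ β g '' Set.range φ
  equivariant : ∀ (g : G) (x : α.dom g⁻¹), β g (φ (x : S)) = φ (α.iso g x : S)
  sum_eq_top : Submodule.span k (⋃ g : G, β g '' Set.range φ) = ⊤

namespace Globalization

variable {α : UnitalPartialAction k G S} {T : Type*} [CommRing T] [Algebra k T]

/-- For an enumeration `h_0 = 1, h_1, …, h_n` of a subgroup `H`, the orthogonal idempotents
`(∏_{j < i} (1 - β_{h_j}(1_S))) β_{h_i}(1_S)` of `T`. -/
def idem (Γ : α.Globalization T) {H : Subgroup G} {n : ℕ} (h : Fin (n + 1) ≃ H)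
    (i : Fin (n + 1)) : T :=
  (∏ j ∈ Finset.Iio i, (1 - Γ.β (h j : G) (Γ.φ 1))) * Γ.β (h i : G) (Γ.φ 1)

/-- The map `ψ_H : T → T`, that is,
`ψ_H t = ∑_{i_1 < ⋯ < i_l} (-1)^(l+1) β_{h_{i_1}}(1_S) ⋯ β_{h_{i_l}}(1_S) β_{h_{i_l}}(t)` (the sum
over all non-empty sets of indices), with the terms of the same last index `i_l = i` collected. -/
def psi (Γ : α.Globalization T) {H : Subgroup G} {n : ℕ} (h : Fin (n + 1) ≃ H) (t : T) : T :=
  ∑ i, Γ.β (h i : G) t * Γ.idem h i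

end Globalization

/-- `α'` is the partial action `α_{G/H}` of `G/H` on `S^{α_H}` induced by `α`. It is defined through
the globalization `(T, β)` of `α`, with `S` regarded as an ideal of `T` through `φ`, and
`e_H = ψ_H(1_S)`: the ideal with index `gH` is generated by the idempotent `β_g(e_H) 1_S`, and
`α_{gH}(x) = β_g(ψ_H(x)) 1_S` for `x` in the ideal with index `g⁻¹H`.
The definition asks that a globalization exists and that these formulas hold for each of them, for
each representative `g` of a coset and for each enumeration of `H` that begins with `1`. Since the
elements of a globalization are determined by families `G → S`, the universe of `T` is no
restriction. -/
def IsInducedQuotient (α : UnitalPartialAction k G S) (H : Subgroup G) [H.Normal]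
    (α' : UnitalPartialAction k (G ⧸ H) (α.restrict H).invariants) : Prop :=
  (∃ (T : Type (max v w)) (_ : CommRing T) (_ : Algebra k T), Nonempty (α.Globalization T)) ∧
  ∀ (T : Type (max v w)) [CommRing T] [Algebra k T] (Γ : α.Globalization T)
    (n : ℕ) (h : Fin (n + 1) ≃ H), h 0 = 1 → ∀ g : G,
      Γ.φ (α'.e (g : G ⧸ H) : S) = Γ.β g (Γ.psi h (Γ.φ 1)) * Γ.φ 1 ∧
      ∀ x : α'.dom (g : G ⧸ H)⁻¹,
        Γ.φ ((α'.iso (g : G ⧸ H) x : (α.restrict H).invariants) : S) =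
          Γ.β g (Γ.psi h (Γ.φ ((x : (α.restrict H).invariants) : S))) * Γ.φ 1

end UnitalPartialAction

/-! Partially defined maps are replaced by the total maps s ↦ α_g(s 1_{g⁻¹}), which satisfy
α_g(α_h(s)) = α_{gh}(s) 1_g; conversely, maps with this law give a unital partial action (`ofAct`).
A globalization T is realized inside the functions G → S, and in T one has α_g(s 1_{g⁻¹}) = β_g(s)
1_S (`φ_act`), so the argument is about a global action.

The element e = e_H is the identity of ∑_{m ∈ H} β_m(S) and is fixed by H. An H-invariant s has
translates β_m(s) that agree on overlaps, and ψ_H(s) is their gluing. Thus ψ_H is an isomorphism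
from S^{α_H} onto T^H e, with inverse multiplication by 1_S (`psi_mul_φ_one`, `psi_φ_proj`). As H is
normal, G/H acts globally on T^H; the induced action is this one cut down to S^{α_H}. Written
through α alone (`inducedValue`), it does not depend on T.

For Galois coordinates, those of S are spread over the β_m(S) to give X_p, Y_p in T with ∑ X_p
β_g(Y_p) = δ_{1,g} e. Nakayama's lemma gives c with tr_H(c) = e (`exists_trace_eq`), and then tr_H(c
X_p), tr_H(Y_p), multiplied by 1_S, are coordinates for G/H. The invariants are compared by testing
equalities against the idempotents β_{gb}(1_S), b ∈ H. -/

theorem IsIdempotentElem.mem_span_singleton_iff {R : Type*} [CommRing R] {e : R}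
    (he : IsIdempotentElem e) {x : R} : x ∈ Ideal.span {e} ↔ x * e = x := by
  rw [Ideal.mem_span_singleton']
  constructor
  · rintro ⟨a, rfl⟩
    rw [mul_assoc, he.eq]
  · exact fun h => ⟨x, h⟩

namespace UnitalPartialAction

variable {k : Type u} {G : Type w} {S : Type v}
  [CommRing k] [Group G] [CommRing S] [Algebra k S]

/-! ### Calculus of the total maps s ↦ α_g(s 1_{g⁻¹}) -/

section Act

variable (α : UnitalPartialAction k G S)

theorem act_mem (g : G) (s : S) : α.act g s ∈ α.dom g := Subtype.property _

theorem act_mul_e (g : G) (s : S) : α.act g s * α.e g = α.act g s :=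
  α.mul_e_of_mem (α.act_mem g s)

theorem act_mul_e_inv (g : G) (s : S) : α.act g (s * α.e g⁻¹) = α.act g s := by
  unfold act
  congr 2
  apply Subtype.ext
  change s * α.e g⁻¹ * α.e g⁻¹ = s * α.e g⁻¹
  rw [mul_assoc, (α.e_idem g⁻¹).eq]

theorem act_coe (g : G) (x : α.dom g⁻¹) : α.act g (x : S) = α.iso g x := by
  unfold act
  congr 2
  exact Subtype.ext (α.mul_e_of_mem x.2)

theorem e_one : α.e 1 = 1 := by
  have h : (1 : S) ∈ α.dom 1 := by rw [α.dom_one]; trivial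
  simpa using α.mul_e_of_mem h

theorem act_identity (s : S) : α.act 1 s = s := by
  unfold act
  rw [α.iso_one]
  simp [e_one]

/-- Since α_g maps S_{g⁻¹} ∩ S_h onto S_g ∩ S_{gh}, it carries the identity of the first ideal to
that of the second. -/
theorem act_e (g h : G) : α.act g (α.e h) = α.e g * α.e (g * h) := by
  have h1 : α.act g (α.e h) ∈ {y | y ∈ α.dom g ∧ y ∈ α.dom (g * h)} := by
    rw [← α.image_inter]
    exact ⟨⟨α.e h * α.e g⁻¹, α.mul_e_mem _ _⟩,
      Ideal.mul_mem_right _ _ (by simpa using α.mul_e_mem h 1), rfl⟩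
  have h2 : α.e g * α.e (g * h) ∈ {y | y ∈ α.dom g ∧ y ∈ α.dom (g * h)} :=
    ⟨by rw [mul_comm]; exact α.mul_e_mem _ _, α.mul_e_mem _ _⟩
  rw [← α.image_inter] at h2
  obtain ⟨w, hw, hw'⟩ := h2
  have h3 : (w : S) * α.e h = w := α.mul_e_of_mem hw
  have h4 : α.act g w = α.e g * α.e (g * h) := (α.act_coe g w).trans hw'
  have h5 : α.e g * α.e (g * h) * α.act g (α.e h) = α.e g * α.e (g * h) := by
    rw [← h4, ← act_mul, h3]
  rw [← h5, mul_comm, ← mul_assoc, α.mul_e_of_mem h1.1, α.mul_e_of_mem h1.2]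

theorem act_act (g h : G) (s : S) : α.act g (α.act h s) = α.act (g * h) s * α.e g := by
  -- The extra factor 1_{(gh)⁻¹} makes α_h land in S_{g⁻¹}, where the composition axiom applies.
  have hz : s * α.e (g * h)⁻¹ * α.e h⁻¹ ∈ α.dom h⁻¹ := α.mul_e_mem _ _
  have hz1 : α.act h (s * α.e (g * h)⁻¹ * α.e h⁻¹) = α.act h s * α.e g⁻¹ := by
    rw [act_mul_e_inv, act_mul, act_e, ← mul_assoc, act_mul_e]
    congr 2
    group
  have hz2 : (α.iso h ⟨_, hz⟩ : S) = α.act h s * α.e g⁻¹ := by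
    rw [← hz1, ← act_coe]
  have hz3 : (α.iso h ⟨_, hz⟩ : S) ∈ α.dom g⁻¹ := by
    rw [hz2]; exact α.mul_e_mem _ _
  obtain ⟨hx, hc⟩ := α.comp g h ⟨_, hz⟩ hz3
  replace hc : α.act g (α.iso h ⟨_, hz⟩) = α.act (g * h) (s * α.e (g * h)⁻¹ * α.e h⁻¹) :=
    ((α.act_coe g ⟨_, hz3⟩).trans hc).trans (α.act_coe (g * h) ⟨_, hx⟩).symm
  rw [hz2, act_mul_e_inv, mul_assoc, mul_comm (α.e (g * h)⁻¹), ← mul_assoc, act_mul_e_inv,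
    act_mul, act_e] at hc
  rw [hc, ← mul_assoc, act_mul_e, mul_inv_cancel_right]

end Act

/-- The unital partial action of `G` on `S` determined by the maps `s ↦ α_g (s 1_{g⁻¹})`. -/
def ofAct (a : G → S →ₗ[k] S) (a_mul : ∀ g s t, a g (s * t) = a g s * a g t)
    (a_one : ∀ s, a 1 s = s) (a_comp : ∀ g h s, a g (a h s) = a (g * h) s * a g 1) :
    UnitalPartialAction k G S :=
  have idem (g : G) : IsIdempotentElem (a g 1) := by
    rw [IsIdempotentElem, ← a_mul, mul_one]
  have mem {g : G} {x : S} : x ∈ Ideal.span {a g 1} ↔ x * a g 1 = x :=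
    (idem g).mem_span_singleton_iff
  have a_mem (g : G) (x : S) : a g x ∈ Ideal.span {a g 1} := by
    rw [mem, ← a_mul, mul_one]
  have a_e (g h : G) : a g (a h 1) = a (g * h) 1 * a g 1 := a_comp g h 1
  { dom g := Ideal.span {a g 1}
    iso g :=
      { toFun x := ⟨a g x, a_mem g x⟩
        map_add' x y := Subtype.ext (map_add (a g) _ _)
        map_smul' r x := Subtype.ext (map_smul (a g) _ _)
        invFun x := ⟨a g⁻¹ x, a_mem g⁻¹ x⟩
        left_inv x := Subtype.ext (by
          change a g⁻¹ (a g x) = x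
          rw [a_comp, inv_mul_cancel, a_one, mem.1 x.2])
        right_inv x := Subtype.ext (by
          change a g (a g⁻¹ x) = x
          rw [a_comp, mul_inv_cancel, a_one, mem.1 x.2]) }
    iso_mul g x y := a_mul g x y
    dom_one := by rw [a_one, Ideal.span_singleton_one]
    iso_one x := a_one x
    image_inter g h := by
      ext y
      constructor
      · rintro ⟨x, hx, rfl⟩
        have hx' : (x : S) * a h 1 = x := mem.1 hx
        refine ⟨a_mem g x, mem.2 ?_⟩
        change a g x * _ = a g x
        rw [← hx', a_mul, a_e, mul_assoc, mul_right_comm (a (g * h) 1), (idem (g * h)).eq]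
      · rintro ⟨h1, h2⟩
        refine ⟨⟨a g⁻¹ y, a_mem g⁻¹ y⟩, mem.2 ?_, ?_⟩
        · change a g⁻¹ y * _ = a g⁻¹ y
          rw [← mem.1 h2, a_mul, a_e, inv_mul_cancel_left, mul_assoc,
            mul_right_comm (a h 1), (idem h).eq]
        · change a g (a g⁻¹ y) = y
          rw [a_comp, mul_inv_cancel, a_one, mem.1 h1]
    comp g h x hx := by
      have hx1 : a h x * a g⁻¹ 1 = a h x := mem.1 hx
      have hx2 : (x : S) * a h⁻¹ 1 = x := mem.1 x.2
      -- Apply a_{h⁻¹} to a_h(x) = a_h(x) 1_{g⁻¹}: the idempotent becomes 1_{(gh)⁻¹} 1_{h⁻¹}, and x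
      -- absorbs the second factor.
      have hx3 : (x : S) = x * a (g * h)⁻¹ 1 := by
        have h1 : a h⁻¹ (a h x) = x := by rw [a_comp, inv_mul_cancel, a_one, hx2]
        conv_lhs => rw [← h1, ← hx1, a_mul, h1, a_e, ← mul_inv_rev, mul_comm (a _ 1), ← mul_assoc,
          hx2]
      refine ⟨mem.2 hx3.symm, ?_⟩
      change a g (a h x) = a (g * h) x
      rw [a_comp, ← hx2, a_mul, a_e, mul_inv_cancel_right, mul_assoc, mul_right_comm, (idem g).eq]
    e g := a g 1
    e_idem := idem
    dom_eq _ := rfl }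

theorem ofAct_act (a : G → S →ₗ[k] S) (a_mul a_one a_comp) (g : G) (s : S) :
    (ofAct a a_mul a_one a_comp).act g s = a g s := by
  change a g (s * a g⁻¹ 1) = a g s
  rw [a_mul, a_comp, mul_inv_cancel, a_one, one_mul, ← a_mul, mul_one]

/-! ### Existence of a globalization inside the functions G → S -/

section Enveloping

/-- The translation action of `G` on the algebra of functions `G → S`. -/
def translation (k : Type u) (G : Type w) (S : Type v) [CommRing k] [Group G] [CommRing S]
    [Algebra k S] : G →* ((G → S) ≃ₐ[k] (G → S)) where
  toFun g := AlgEquiv.ofAlgHom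
    (AlgHom.ofLinearMap (LinearMap.funLeft k S (g⁻¹ * ·)) rfl fun _ _ => rfl)
    (AlgHom.ofLinearMap (LinearMap.funLeft k S (g * ·)) rfl fun _ _ => rfl)
    (by ext f x; simp [LinearMap.funLeft]) (by ext f x; simp [LinearMap.funLeft])
  map_one' := by ext f x; simp [LinearMap.funLeft]
  map_mul' g h := by ext f x; simp [LinearMap.funLeft, mul_assoc]

theorem translation_apply (g : G) (f : G → S) (x : G) :
    translation k G S g f x = f (g⁻¹ * x) := rfl

variable (α : UnitalPartialAction k G S)

/-- The embedding of `S` in the algebra of functions `G → S`, `s ↦ (x ↦ α_{x⁻¹} (s 1_x))`. -/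
def toFunctions : S →ₙₐ[k] (G → S) where
  toFun s x := α.act x⁻¹ s
  map_smul' r s := funext fun _ => α.act_smul _ _ _
  map_zero' := funext fun x => by simpa using α.act_smul x⁻¹ 0 0
  map_add' s t := funext fun _ => α.act_add _ _ _
  map_mul' s t := funext fun _ => α.act_mul _ _ _

theorem toFunctions_apply (s : S) (x : G) : α.toFunctions s x = α.act x⁻¹ s := rfl

theorem toFunctions_injective : Function.Injective α.toFunctions := fun s t h => by
  simpa [toFunctions_apply, act_identity] using congrFun h 1

/-- At x this is the composition law for x⁻¹ and g, whose defect 1_{x⁻¹} is absorbed by α_{x⁻¹}(s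
1_x). It makes the image of S an ideal. -/
theorem translation_mul_toFunctions (g : G) (s t : S) :
    translation k G S g (α.toFunctions t) * α.toFunctions s = α.toFunctions (α.act g t * s) := by
  ext x
  rw [Pi.mul_apply, translation_apply, toFunctions_apply, toFunctions_apply, toFunctions_apply,
    act_mul, act_act, mul_assoc, mul_comm (α.e x⁻¹), act_mul_e, mul_inv_rev, inv_inv]

theorem translation_toFunctions (g : G) (x : α.dom g⁻¹) :
    translation k G S g (α.toFunctions x) = α.toFunctions (α.iso g x) := by
  ext y
  rw [translation_apply, toFunctions_apply, toFunctions_apply, ← act_coe, act_act, mul_inv_rev,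
    inv_inv]
  conv_lhs => rw [← α.mul_e_of_mem x.2, act_mul, act_e, mul_inv_cancel_right, ← mul_assoc,
    act_mul_e]

/-- The span of the translates of the image of `S` in `G → S`. -/
def envelopingSubmodule : Submodule k (G → S) :=
  Submodule.span k (⋃ g : G, translation k G S g '' Set.range α.toFunctions)

theorem translation_toFunctions_mem (g : G) (s : S) :
    translation k G S g (α.toFunctions s) ∈ α.envelopingSubmodule :=
  Submodule.subset_span (Set.mem_iUnion.2 ⟨g, _, ⟨s, rfl⟩, rfl⟩)

theorem mul_mem_envelopingSubmodule {a b : G → S} (ha : a ∈ α.envelopingSubmodule)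
    (hb : b ∈ α.envelopingSubmodule) : a * b ∈ α.envelopingSubmodule := by
  have h := Submodule.mul_mem_mul ha hb
  unfold envelopingSubmodule at h
  rw [Submodule.span_mul_span] at h
  refine Submodule.span_le.2 ?_ h
  rintro _ ⟨_, ha, _, hb, rfl⟩
  obtain ⟨g, _, ⟨s, rfl⟩, rfl⟩ := Set.mem_iUnion.1 ha
  obtain ⟨g', _, ⟨t, rfl⟩, rfl⟩ := Set.mem_iUnion.1 hb
  have : translation k G S g (α.toFunctions s) * translation k G S g' (α.toFunctions t) =
      translation k G S g' (α.toFunctions (α.act (g'⁻¹ * g) s * t)) := by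
    rw [← translation_mul_toFunctions, map_mul, ← AlgEquiv.mul_apply, ← map_mul,
      mul_inv_cancel_left]
  dsimp only
  rw [this]
  exact α.translation_toFunctions_mem _ _

theorem translation_mem_envelopingSubmodule (g : G) {a : G → S}
    (ha : a ∈ α.envelopingSubmodule) : translation k G S g a ∈ α.envelopingSubmodule := by
  suffices h : α.envelopingSubmodule ≤
      α.envelopingSubmodule.comap (translation k G S g).toLinearMap from h ha
  refine Submodule.span_le.2 ?_
  rintro _ ha
  obtain ⟨g', _, ⟨s, rfl⟩, rfl⟩ := Set.mem_iUnion.1 ha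
  change translation k G S g (translation k G S g' (α.toFunctions s)) ∈ α.envelopingSubmodule
  rw [← AlgEquiv.mul_apply, ← map_mul]
  exact α.translation_toFunctions_mem _ _

/-- The product of all 1 - β_g(1_S) is zero, because its factor g = x vanishes at x; expanding it
writes 1 as a combination of products of translates. -/
theorem one_mem_envelopingSubmodule [Finite G] : 1 ∈ α.envelopingSubmodule := by
  cases nonempty_fintype G
  have key : ∀ s : Finset G,
      1 - ∏ g ∈ s, (1 - translation k G S g (α.toFunctions 1)) ∈ α.envelopingSubmodule := by
    classical
    intro s
    induction s using Finset.induction_on with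
    | empty => simp
    | insert g s hg ih =>
      rw [Finset.prod_insert hg]
      have h1 := α.translation_toFunctions_mem g 1
      have h2 := Submodule.sub_mem _ (Submodule.add_mem _ ih h1)
        (α.mul_mem_envelopingSubmodule h1 ih)
      convert h2 using 1
      ring
  have h0 : ∏ g : G, (1 - translation k G S g (α.toFunctions 1)) = 0 := by
    ext x
    rw [Finset.prod_apply]
    refine Finset.prod_eq_zero (Finset.mem_univ x) ?_
    simp [translation_apply, toFunctions_apply, act_identity]
  simpa [h0] using key Finset.univ

/-- The algebra generated by the translates of `S` in `G → S`. -/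
def envelopingAlgebra [Finite G] : Subalgebra k (G → S) :=
  α.envelopingSubmodule.toSubalgebra α.one_mem_envelopingSubmodule
    fun _ _ => α.mul_mem_envelopingSubmodule

/-- Translation by an element of `G` on the enveloping algebra. -/
def envelopingTranslation [Finite G] (g : G) : α.envelopingAlgebra →ₐ[k] α.envelopingAlgebra :=
  ((translation k G S g : (G → S) →ₐ[k] (G → S)).comp α.envelopingAlgebra.val).codRestrict _
    fun a => α.translation_mem_envelopingSubmodule g a.2

theorem coe_envelopingTranslation [Finite G] (g : G) (a : α.envelopingAlgebra) :
    (α.envelopingTranslation g a : G → S) = translation k G S g a := rfl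

/-- The translation action on the enveloping algebra. -/
def envelopingAction [Finite G] : G →* (α.envelopingAlgebra ≃ₐ[k] α.envelopingAlgebra) where
  toFun g := AlgEquiv.ofAlgHom (α.envelopingTranslation g) (α.envelopingTranslation g⁻¹)
    (AlgHom.ext fun a => Subtype.ext <| by simp [coe_envelopingTranslation])
    (AlgHom.ext fun a => Subtype.ext <| by simp [coe_envelopingTranslation])
  map_one' := AlgEquiv.ext fun a => Subtype.ext <| by simp [coe_envelopingTranslation]
  map_mul' g h := AlgEquiv.ext fun a => Subtype.ext <| by simp [coe_envelopingTranslation]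

theorem coe_envelopingAction [Finite G] (g : G) (a : α.envelopingAlgebra) :
    (α.envelopingAction g a : G → S) = translation k G S g a := rfl

theorem toFunctions_mem [Finite G] (s : S) : α.toFunctions s ∈ α.envelopingAlgebra := by
  have h := α.translation_toFunctions_mem 1 s
  rwa [map_one, AlgEquiv.one_apply] at h

/-- The embedding of `S` in its enveloping algebra. -/
def toEnveloping [Finite G] : S →ₙₐ[k] α.envelopingAlgebra where
  toFun s := ⟨α.toFunctions s, α.toFunctions_mem s⟩
  map_smul' r s := Subtype.ext (map_smul α.toFunctions r s)
  map_zero' := Subtype.ext (map_zero α.toFunctions)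
  map_add' s t := Subtype.ext (map_add α.toFunctions s t)
  map_mul' s t := Subtype.ext (map_mul α.toFunctions s t)

theorem coe_toEnveloping [Finite G] (s : S) :
    (α.toEnveloping s : G → S) = α.toFunctions s := rfl

/-- The standard globalization of a unital partial action of a finite group. -/
def envelopingGlobalization [Finite G] : α.Globalization α.envelopingAlgebra where
  β := α.envelopingAction
  φ := α.toEnveloping
  φ_injective s t h := α.toFunctions_injective (congrArg Subtype.val h)
  range_ideal := by
    rintro ⟨t, ht⟩ s
    induction ht using Submodule.span_induction with
    | mem t ht =>
      obtain ⟨g, _, ⟨r, rfl⟩, rfl⟩ := Set.mem_iUnion.1 ht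
      exact ⟨α.act g r * s, Subtype.ext (α.translation_mul_toFunctions g s r).symm⟩
    | zero => exact ⟨0, Subtype.ext (by simp [coe_toEnveloping])⟩
    | add x y hx hy ihx ihy =>
      obtain ⟨a, ha⟩ := ihx
      obtain ⟨b, hb⟩ := ihy
      have ha' := congrArg Subtype.val ha
      have hb' := congrArg Subtype.val hb
      refine ⟨a + b, Subtype.ext ?_⟩
      rw [map_add, Subalgebra.coe_add, ha', hb']
      exact (add_mul x y _).symm
    | smul r x hx ih =>
      obtain ⟨a, ha⟩ := ih
      have ha' := congrArg Subtype.val ha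
      refine ⟨r • a, Subtype.ext ?_⟩
      rw [map_smul, Subalgebra.coe_smul, ha']
      exact (smul_mul_assoc r x _).symm
  image_dom g := by
    ext t
    constructor
    · rintro ⟨s, hs, rfl⟩
      refine ⟨⟨s, rfl⟩, ?_⟩
      obtain ⟨x, hx⟩ := (α.iso g).surjective ⟨s, hs⟩
      refine ⟨α.toEnveloping (x : S), ⟨x, rfl⟩, Subtype.ext ?_⟩
      rw [coe_envelopingAction, coe_toEnveloping, translation_toFunctions, hx]
      rfl
    · rintro ⟨⟨s, rfl⟩, _, ⟨r, rfl⟩, h⟩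
      have h' : translation k G S g (α.toFunctions r) = α.toFunctions s := congrArg Subtype.val h
      -- If β_g(r) = s, multiplying by 1_S gives s = α_g(r 1_{g⁻¹}) ∈ S_g.
      have h1 := α.translation_mul_toFunctions g 1 r
      rw [h', ← map_mul, mul_one, mul_one] at h1
      refine ⟨s, ?_, rfl⟩
      rw [α.toFunctions_injective h1]
      exact α.act_mem g r
  equivariant g x := Subtype.ext (α.translation_toFunctions g x)
  sum_eq_top := by
    rw [eq_top_iff]
    have hinj : Function.Injective α.envelopingAlgebra.val.toLinearMap := Subtype.val_injective
    rw [← Submodule.map_le_map_iff_of_injective hinj, Submodule.map_span]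
    rintro _ ⟨t, -, rfl⟩
    refine Submodule.span_mono ?_ t.2
    intro a ha
    obtain ⟨g, _, ⟨s, rfl⟩, rfl⟩ := Set.mem_iUnion.1 ha
    exact ⟨α.envelopingAction g (α.toEnveloping s),
      Set.mem_iUnion.2 ⟨g, _, ⟨s, rfl⟩, rfl⟩, rfl⟩

end Enveloping

end UnitalPartialAction

namespace UnitalPartialAction

variable {k : Type u} {G : Type w} {S : Type v}
  [CommRing k] [Group G] [CommRing S] [Algebra k S]

namespace Globalization

variable {α : UnitalPartialAction k G S} {T : Type*} [CommRing T] [Algebra k T]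

/-! ### The partial action and its invariants seen in a globalization -/

section Basic

variable (Γ : α.Globalization T)

theorem β_mul_apply (g h : G) (t : T) : Γ.β (g * h) t = Γ.β g (Γ.β h t) := by
  rw [map_mul, AlgEquiv.mul_apply]

theorem β_one_apply (t : T) : Γ.β 1 t = t := by
  rw [map_one, AlgEquiv.one_apply]

theorem φ_mul_φ_one (s : S) : Γ.φ s * Γ.φ 1 = Γ.φ s := by
  rw [← map_mul, mul_one]

theorem φ_e (g : G) : Γ.φ (α.e g) = Γ.β g (Γ.φ 1) * Γ.φ 1 := by
  have h1 : Γ.φ (α.e g) * Γ.β g (Γ.φ 1) = Γ.φ (α.e g) := by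
    have he : Γ.φ (α.e g) ∈ Γ.φ '' (α.dom g : Set S) :=
      ⟨_, by simpa using α.mul_e_mem g 1, rfl⟩
    rw [Γ.image_dom] at he
    obtain ⟨-, _, ⟨s, rfl⟩, hs⟩ := he
    rw [← hs, ← map_mul, φ_mul_φ_one]
  have h2 : Γ.β g (Γ.φ 1) * Γ.φ 1 ∈ Γ.φ '' (α.dom g : Set S) := by
    rw [Γ.image_dom]
    refine ⟨Γ.range_ideal _ _, ?_⟩
    obtain ⟨s, hs⟩ := Γ.range_ideal (Γ.β g⁻¹ (Γ.φ 1)) 1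
    refine ⟨_, ⟨s, rfl⟩, ?_⟩
    rw [hs, map_mul, ← β_mul_apply, mul_inv_cancel, β_one_apply, mul_comm]
  obtain ⟨d, hd, hd'⟩ := h2
  have h3 := congrArg Γ.φ (α.mul_e_of_mem hd)
  rw [map_mul, hd'] at h3
  rw [← h3, mul_assoc, mul_comm (Γ.φ 1), φ_mul_φ_one, mul_comm, h1]

/-- Equivariance covers only S_{g⁻¹}; since β_g(1_{g⁻¹}) = 1_S β_g(1_S), cutting s by 1_{g⁻¹}
beforehand amounts to multiplying by 1_S afterwards. -/
theorem φ_act (g : G) (s : S) : Γ.φ (α.act g s) = Γ.β g (Γ.φ s) * Γ.φ 1 := by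
  have h (x : α.dom g⁻¹) : Γ.φ (α.act g x) = Γ.β g (Γ.φ x) := by
    rw [act_coe, Γ.equivariant]
  have h1 : Γ.φ (α.act g (s * α.e g⁻¹)) = Γ.β g (Γ.φ (s * α.e g⁻¹)) :=
    h ⟨_, α.mul_e_mem g⁻¹ s⟩
  have h2 : Γ.β g (Γ.φ (α.e g⁻¹)) = Γ.φ 1 * Γ.β g (Γ.φ 1) := by
    rw [φ_e, map_mul, ← β_mul_apply, mul_inv_cancel, β_one_apply]
  rw [← act_mul_e_inv, h1, map_mul, map_mul, h2, mul_comm (Γ.φ 1), ← mul_assoc, ← map_mul,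
    φ_mul_φ_one]

theorem exists_φ_eq (t : T) : ∃ s, Γ.φ s = t * Γ.φ 1 := Γ.range_ideal t 1

/-- Multiplication by `1_S`, as a map from `T` to `S`. -/
noncomputable def proj : T →ₗ[k] S where
  toFun t := (Γ.exists_φ_eq t).choose
  map_add' a b := Γ.φ_injective <| by
    rw [map_add, (Γ.exists_φ_eq _).choose_spec, (Γ.exists_φ_eq _).choose_spec,
      (Γ.exists_φ_eq _).choose_spec, add_mul]
  map_smul' r a := Γ.φ_injective <| by
    rw [map_smul, (Γ.exists_φ_eq _).choose_spec, (Γ.exists_φ_eq _).choose_spec, smul_mul_assoc]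
    rfl

theorem φ_proj (t : T) : Γ.φ (Γ.proj t) = t * Γ.φ 1 := (Γ.exists_φ_eq t).choose_spec

/-- The subalgebra of `T` of the elements fixed by a subgroup. -/
def fixed (H : Subgroup G) : Subalgebra k T where
  carrier := {t | ∀ m : H, Γ.β m t = t}
  mul_mem' ha hb m := by rw [map_mul, ha m, hb m]
  add_mem' ha hb m := by rw [map_add, ha m, hb m]
  algebraMap_mem' r m := by rw [AlgEquiv.commutes]

theorem β_mem_fixed {H : Subgroup G} [hH : H.Normal] (g : G) {t : T} (ht : t ∈ Γ.fixed H) :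
    Γ.β g t ∈ Γ.fixed H := fun m => by
  have h := ht ⟨g⁻¹ * m * g, by simpa using hH.conj_mem m m.2 g⁻¹⟩
  dsimp only at h
  conv_rhs => rw [← h]
  rw [← β_mul_apply, ← β_mul_apply]
  congr 2
  group

theorem β_eq_of_coe_eq {H : Subgroup G} {g g' : G} (hg : (g : G ⧸ H) = g') {t : T}
    (ht : t ∈ Γ.fixed H) : Γ.β g t = Γ.β g' t := by
  have h := ht ⟨_, QuotientGroup.eq.1 hg⟩
  dsimp only at h
  conv_lhs => rw [← h]
  rw [← β_mul_apply, mul_inv_cancel_left]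

theorem mem_invariants_iff {H : Subgroup G} {s : S} : s ∈ (α.restrict H).invariants ↔
    ∀ m : H, Γ.β m (Γ.φ s) * Γ.φ 1 = Γ.φ s * Γ.β m (Γ.φ 1) := by
  refine forall_congr' fun m => ?_
  rw [← Γ.φ_injective.eq_iff]
  change Γ.φ (α.act m s) = Γ.φ (s * α.e m) ↔ _
  rw [map_mul, φ_act, φ_e, mul_comm (Γ.β m (Γ.φ 1)), ← mul_assoc, φ_mul_φ_one]

/-- The gluing condition: it is the invariance of s under b⁻¹a, moved by β_b. -/
theorem β_φ_mul_β_φ_one {H : Subgroup G} {s : S} (hs : s ∈ (α.restrict H).invariants)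
    (a b : H) : Γ.β a (Γ.φ s) * Γ.β b (Γ.φ 1) = Γ.β b (Γ.φ s) * Γ.β a (Γ.φ 1) := by
  have h := congrArg (Γ.β b) (Γ.mem_invariants_iff.1 hs (b⁻¹ * a))
  rwa [map_mul, map_mul, ← β_mul_apply, ← β_mul_apply, Subgroup.coe_mul, Subgroup.coe_inv,
    mul_inv_cancel_left] at h

theorem proj_mem_invariants {H : Subgroup G} {t : T} (ht : t ∈ Γ.fixed H) :
    Γ.proj t ∈ (α.restrict H).invariants := by
  rw [Γ.mem_invariants_iff]
  intro m
  rw [φ_proj, map_mul, ht m]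
  ring

end Basic

/-! ### The map ψ_H and the idempotent e_H -/

section Psi

variable (Γ : α.Globalization T) {H : Subgroup G} {n : ℕ} (h : Fin (n + 1) ≃ H)

theorem psi_add (a b : T) : Γ.psi h (a + b) = Γ.psi h a + Γ.psi h b := by
  simp only [psi, map_add, add_mul, Finset.sum_add_distrib]

theorem psi_smul (r : k) (a : T) : Γ.psi h (r • a) = r • Γ.psi h a := by
  simp only [psi, map_smul, smul_mul_assoc, Finset.smul_sum]

theorem isIdempotentElem_β_φ_one (g : G) : IsIdempotentElem (Γ.β g (Γ.φ 1)) := by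
  rw [IsIdempotentElem, ← map_mul, φ_mul_φ_one]

theorem β_mul_idem (i : Fin (n + 1)) : Γ.β (h i : G) (Γ.φ 1) * Γ.idem h i = Γ.idem h i := by
  rw [idem, mul_left_comm, (Γ.isIdempotentElem_β_φ_one _).eq]

theorem psi_φ_one : Γ.psi h (Γ.φ 1) = ∑ i, Γ.idem h i :=
  Finset.sum_congr rfl fun i _ => Γ.β_mul_idem h i

theorem psi_φ_one_eq_one_sub_prod :
    Γ.psi h (Γ.φ 1) = 1 - ∏ i, (1 - Γ.β (h i : G) (Γ.φ 1)) := by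
  rw [psi_φ_one, Finset.prod_one_sub_ordered, sub_sub_cancel]
  refine Finset.sum_congr rfl fun i _ => ?_
  rw [idem, mul_comm]
  congr 2
  ext j
  simp

theorem β_φ_one_mul_psi (m : H) :
    Γ.β m (Γ.φ 1) * Γ.psi h (Γ.φ 1) = Γ.β m (Γ.φ 1) := by
  rw [psi_φ_one_eq_one_sub_prod, mul_sub, mul_one, sub_eq_self,
    ← Finset.mul_prod_erase _ _ (Finset.mem_univ (h.symm m)), h.apply_symm_apply, ← mul_assoc,
    mul_sub, mul_one, (Γ.isIdempotentElem_β_φ_one _).eq, sub_self, zero_mul]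

theorem φ_one_mul_psi : Γ.φ 1 * Γ.psi h (Γ.φ 1) = Γ.φ 1 := by
  simpa using Γ.β_φ_one_mul_psi h 1

theorem idem_mul_psi {n' : ℕ} (h' : Fin (n' + 1) ≃ H) (i : Fin (n' + 1)) :
    Γ.idem h' i * Γ.psi h (Γ.φ 1) = Γ.idem h' i := by
  rw [idem, mul_assoc, β_φ_one_mul_psi]

theorem psi_mul_psi {n' : ℕ} (h' : Fin (n' + 1) ≃ H) (t : T) :
    Γ.psi h' t * Γ.psi h (Γ.φ 1) = Γ.psi h' t := by
  conv_lhs => rw [psi, Finset.sum_mul]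
  exact Finset.sum_congr rfl fun i _ => by rw [mul_assoc, idem_mul_psi]

/-- e_H is a combination of the β_m(1_S), so these idempotents separate the elements of T e_H.
Identities for ψ_H are checked on them. -/
theorem eq_of_mul_β {a b : T} (ha : a * Γ.psi h (Γ.φ 1) = a) (hb : b * Γ.psi h (Γ.φ 1) = b)
    (hab : ∀ m : H, a * Γ.β m (Γ.φ 1) = b * Γ.β m (Γ.φ 1)) : a = b := by
  rw [← ha, ← hb, psi, Finset.mul_sum, Finset.mul_sum]
  exact Finset.sum_congr rfl fun i _ => by rw [← mul_assoc, hab, mul_assoc]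

theorem psi_φ_one_mem_fixed : Γ.psi h (Γ.φ 1) ∈ Γ.fixed H := fun m => by
  refine Γ.eq_of_mul_β h ?_ (Γ.psi_mul_psi h h _) fun a => ?_
  · conv_lhs => rw [psi, map_sum, Finset.sum_mul]
    conv_rhs => rw [psi, map_sum]
    refine Finset.sum_congr rfl fun i _ => ?_
    have := Γ.β_φ_one_mul_psi h (m * h i)
    rw [Subgroup.coe_mul, β_mul_apply] at this
    rw [map_mul, mul_right_comm]
    exact congrArg (· * _) this
  · have := congrArg (Γ.β m) (Γ.β_φ_one_mul_psi h (m⁻¹ * a))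
    rw [map_mul, ← β_mul_apply, Subgroup.coe_mul, Subgroup.coe_inv, mul_inv_cancel_left] at this
    rw [mul_comm, this, mul_comm, β_φ_one_mul_psi]

/-- By the gluing condition each summand of ψ_H(s) may exchange β_{h_i}(s) for β_m(s), and the
idempotents left over sum to e_H. -/
theorem psi_mul_β {s : S} (hs : s ∈ (α.restrict H).invariants) (m : H) :
    Γ.psi h (Γ.φ s) * Γ.β m (Γ.φ 1) = Γ.β m (Γ.φ s) := by
  have h1 : Γ.β m (Γ.φ s) * Γ.psi h (Γ.φ 1) = Γ.β m (Γ.φ s) := by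
    conv_lhs => rw [← Γ.φ_mul_φ_one s, map_mul, mul_assoc, β_φ_one_mul_psi, ← map_mul,
      φ_mul_φ_one]
  rw [← h1, psi, psi, Finset.sum_mul, Finset.mul_sum]
  refine Finset.sum_congr rfl fun i _ => ?_
  rw [mul_right_comm, Γ.β_φ_mul_β_φ_one hs, mul_assoc]

theorem psi_mul_φ_one {s : S} (hs : s ∈ (α.restrict H).invariants) :
    Γ.psi h (Γ.φ s) * Γ.φ 1 = Γ.φ s := by
  simpa using Γ.psi_mul_β h hs 1

theorem psi_mem_fixed {s : S} (hs : s ∈ (α.restrict H).invariants) :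
    Γ.psi h (Γ.φ s) ∈ Γ.fixed H := fun m => by
  refine Γ.eq_of_mul_β h ?_ (Γ.psi_mul_psi h h _) fun a => ?_
  · conv_lhs => rw [← Γ.psi_φ_one_mem_fixed h m, ← map_mul, psi_mul_psi]
  · have := congrArg (Γ.β m) (Γ.psi_mul_β h hs (m⁻¹ * a))
    rw [map_mul, ← β_mul_apply, ← β_mul_apply, Subgroup.coe_mul, Subgroup.coe_inv,
      mul_inv_cancel_left] at this
    rw [this, psi_mul_β _ _ hs]

theorem psi_eq_psi {n' : ℕ} (h' : Fin (n' + 1) ≃ H) {s : S}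
    (hs : s ∈ (α.restrict H).invariants) : Γ.psi h (Γ.φ s) = Γ.psi h' (Γ.φ s) :=
  Γ.eq_of_mul_β h (Γ.psi_mul_psi h h _) (Γ.psi_mul_psi h h' _) fun m => by
    rw [psi_mul_β _ _ hs, psi_mul_β _ _ hs]

theorem psi_mul {s t : S} (hs : s ∈ (α.restrict H).invariants)
    (ht : t ∈ (α.restrict H).invariants) :
    Γ.psi h (Γ.φ (s * t)) = Γ.psi h (Γ.φ s) * Γ.psi h (Γ.φ t) := by
  refine Γ.eq_of_mul_β h (Γ.psi_mul_psi h h _) ?_ fun m => ?_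
  · rw [mul_assoc, psi_mul_psi]
  · rw [psi_mul_β _ _ (mul_mem hs ht), mul_assoc, psi_mul_β _ _ ht, ← Γ.φ_mul_φ_one t,
      map_mul (Γ.β _), mul_left_comm, psi_mul_β _ _ hs, map_mul, map_mul, mul_comm]

theorem psi_φ_proj {t : T} (ht : t ∈ Γ.fixed H) :
    Γ.psi h (Γ.φ (Γ.proj t)) = t * Γ.psi h (Γ.φ 1) := by
  rw [psi, psi, Finset.mul_sum]
  exact Finset.sum_congr rfl fun i _ => by rw [φ_proj, map_mul, ht, mul_assoc]

end Psi

end Globalization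

/-! ### The induced partial action of G/H -/

section Quotient

/-- The value of `β_g (ψ_H s) 1_S` expressed through the partial action only. -/
def inducedValue (α : UnitalPartialAction k G S) {H : Subgroup G} {n : ℕ}
    (h : Fin (n + 1) ≃ H) (g : G) (s : S) : S :=
  ∑ i, α.act (g * h i) s * ∏ j ∈ Finset.Iio i, (1 - α.e (g * h j))

variable {α : UnitalPartialAction k G S} {T : Type*} [CommRing T] [Algebra k T]

namespace Globalization

theorem φ_mul_prod_one_sub (Γ : α.Globalization T) {ι : Type*} (s : Finset ι) (f : ι → G)
    (a : S) : Γ.φ (a * ∏ j ∈ s, (1 - α.e (f j))) =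
      Γ.φ a * ∏ j ∈ s, (1 - Γ.β (f j) (Γ.φ 1)) := by
  classical
  induction s using Finset.induction_on with
  | empty => simp
  | insert j s hj ih =>
    rw [Finset.prod_insert hj, Finset.prod_insert hj, mul_left_comm, sub_mul, one_mul, map_sub,
      map_mul Γ.φ (α.e (f j)), ih, φ_e]
    linear_combination -(Γ.β (f j) (Γ.φ 1) * ∏ j ∈ s, (1 - Γ.β (f j) (Γ.φ 1))) * Γ.φ_mul_φ_one a

theorem φ_inducedValue (Γ : α.Globalization T) {H : Subgroup G} {n : ℕ}
    (h : Fin (n + 1) ≃ H) (g : G) (s : S) :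
    Γ.φ (α.inducedValue h g s) = Γ.β g (Γ.psi h (Γ.φ s)) * Γ.φ 1 := by
  rw [inducedValue, psi, map_sum, map_sum, Finset.sum_mul]
  refine Finset.sum_congr rfl fun i _ => ?_
  have h1 : Γ.β g (Γ.β (h i : G) (Γ.φ s)) * Γ.β g (Γ.β (h i : G) (Γ.φ 1)) =
      Γ.β g (Γ.β (h i : G) (Γ.φ s)) := by rw [← map_mul, ← map_mul, φ_mul_φ_one]
  rw [φ_mul_prod_one_sub, φ_act, idem, map_mul (Γ.β g), map_mul (Γ.β g), map_prod]
  simp only [β_mul_apply, map_sub, map_one]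
  linear_combination
    -((∏ j ∈ Finset.Iio i, (1 - Γ.β g (Γ.β (h j : G) (Γ.φ 1)))) * Γ.φ 1) * h1

theorem inducedValue_eq (Γ : α.Globalization T) {H : Subgroup G} {n n' : ℕ}
    (h : Fin (n + 1) ≃ H) (h' : Fin (n' + 1) ≃ H) (g : G) {s : S}
    (hs : s ∈ (α.restrict H).invariants) : α.inducedValue h g s = α.inducedValue h' g s :=
  Γ.φ_injective <| by rw [φ_inducedValue, φ_inducedValue, Γ.psi_eq_psi h h' hs]

variable (Γ : α.Globalization T) {H : Subgroup G} [H.Normal] {n : ℕ} (h : Fin (n + 1) ≃ H)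

/-- The map `x ↦ β_g (ψ_H x) 1_S` on the invariants of `H`. -/
noncomputable def quotientMap (q : G ⧸ H) :
    (α.restrict H).invariants →ₗ[k] (α.restrict H).invariants where
  toFun x := ⟨Γ.proj (Γ.β q.out (Γ.psi h (Γ.φ x))),
    Γ.proj_mem_invariants (Γ.β_mem_fixed _ (Γ.psi_mem_fixed h x.2))⟩
  map_add' x y := Subtype.ext <| by
    simp only [Subalgebra.coe_add, map_add, psi_add]
  map_smul' r x := Subtype.ext <| by
    simp only [Subalgebra.coe_smul, map_smul, psi_smul, RingHom.id_apply]

theorem coe_quotientMap (g : G) (x : (α.restrict H).invariants) :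
    (Γ.quotientMap h (g : G ⧸ H) x : S) = Γ.proj (Γ.β g (Γ.psi h (Γ.φ x))) := by
  change Γ.proj _ = _
  rw [Γ.β_eq_of_coe_eq (QuotientGroup.out_eq' (g : G ⧸ H)) (Γ.psi_mem_fixed h x.2)]

theorem φ_quotientMap (g : G) (x : (α.restrict H).invariants) :
    Γ.φ (Γ.quotientMap h (g : G ⧸ H) x : S) = Γ.β g (Γ.psi h (Γ.φ x)) * Γ.φ 1 := by
  rw [coe_quotientMap, φ_proj]

/-- The unital partial action of `G/H` on the invariants of `H` constructed from a
globalization. -/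
noncomputable def quotientAction : UnitalPartialAction k (G ⧸ H) (α.restrict H).invariants :=
  ofAct (Γ.quotientMap h)
    (fun q x y => by
      obtain ⟨g, rfl⟩ := QuotientGroup.mk_surjective q
      refine Subtype.ext (Γ.φ_injective ?_)
      rw [φ_quotientMap, Subalgebra.coe_mul, Subalgebra.coe_mul, Γ.psi_mul h x.2 y.2, map_mul,
        map_mul, φ_quotientMap, φ_quotientMap]
      linear_combination
        -(Γ.β g (Γ.psi h (Γ.φ x)) * Γ.β g (Γ.psi h (Γ.φ y))) * Γ.φ_mul_φ_one 1)
    (fun x => by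
      refine Subtype.ext (Γ.φ_injective ?_)
      rw [← QuotientGroup.mk_one, φ_quotientMap, β_one_apply, Γ.psi_mul_φ_one h x.2])
    -- ψ_H(t 1_S) = t e_H for t fixed by H; the factor β_g(e_H) so produced is the defect 1_{gH}
    -- required by the composition law.
    (fun q q' x => by
      obtain ⟨g, rfl⟩ := QuotientGroup.mk_surjective q
      obtain ⟨g', rfl⟩ := QuotientGroup.mk_surjective q'
      refine Subtype.ext (Γ.φ_injective ?_)
      rw [φ_quotientMap, coe_quotientMap,
        Γ.psi_φ_proj h (Γ.β_mem_fixed _ (Γ.psi_mem_fixed h x.2)), ← QuotientGroup.mk_mul,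
        Subalgebra.coe_mul, map_mul Γ.φ, φ_quotientMap, φ_quotientMap, Subalgebra.coe_one,
        map_mul (Γ.β g), β_mul_apply]
      linear_combination
        -(Γ.β g (Γ.β g' (Γ.psi h (Γ.φ x))) * Γ.β g (Γ.psi h (Γ.φ 1))) * Γ.φ_mul_φ_one 1)

theorem quotientAction_act (q : G ⧸ H) (x : (α.restrict H).invariants) :
    (Γ.quotientAction h).act q x = Γ.quotientMap h q x := ofAct_act ..

theorem quotientAction_e (q : G ⧸ H) :
    (Γ.quotientAction h).e q = Γ.quotientMap h q 1 := rfl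

theorem quotientMap_eq_inducedValue (g : G) (x : (α.restrict H).invariants) :
    (Γ.quotientMap h (g : G ⧸ H) x : S) = α.inducedValue h g x :=
  Γ.φ_injective <| by rw [φ_quotientMap, φ_inducedValue]

end Globalization

/-- The action built from the enveloping algebra is given by `inducedValue`, which involves no
globalization and, on invariants, no choice of enumeration; so it has the required form in every T.
-/
theorem isInducedQuotient_quotientAction [Finite G] (H : Subgroup G) [H.Normal] {n : ℕ}
    (h : Fin (n + 1) ≃ H) :
    α.IsInducedQuotient H (α.envelopingGlobalization.quotientAction h) := by
  refine ⟨⟨α.envelopingAlgebra, inferInstance, inferInstance, ⟨α.envelopingGlobalization⟩⟩,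
    fun T _ _ Γ n' h' _ g => ?_⟩
  have key (x : (α.restrict H).invariants) :
      Γ.φ (α.envelopingGlobalization.quotientMap h (g : G ⧸ H) x : S) =
        Γ.β g (Γ.psi h' (Γ.φ x)) * Γ.φ 1 := by
    rw [Globalization.quotientMap_eq_inducedValue, Γ.inducedValue_eq h h' g x.2,
      Γ.φ_inducedValue]
  exact ⟨key 1, fun x => key x⟩

end Quotient

end UnitalPartialAction

namespace UnitalPartialAction

variable {k : Type u} {G : Type w} {S : Type v}
  [CommRing k] [Group G] [CommRing S] [Algebra k S]

namespace Globalization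

variable {α : UnitalPartialAction k G S} {T : Type*} [CommRing T] [Algebra k T]
  (Γ : α.Globalization T) {H : Subgroup G}

/-! ### Traces and an element of trace e_H -/

section Trace

variable [Fintype H]

/-- The trace map `t ↦ ∑_{h ∈ H} β_h(t)`. -/
def trace (H : Subgroup G) [Fintype H] (t : T) : T := ∑ m : H, Γ.β m t

theorem trace_mem_fixed (t : T) : Γ.trace H t ∈ Γ.fixed H := fun m => by
  rw [trace, map_sum]
  exact Fintype.sum_equiv (Equiv.mulLeft m) _ _ fun a => by
    rw [Equiv.coe_mulLeft, Subgroup.coe_mul, β_mul_apply]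

theorem trace_add (a b : T) : Γ.trace H (a + b) = Γ.trace H a + Γ.trace H b := by
  simp only [trace, map_add, Finset.sum_add_distrib]

theorem trace_mul {a : T} (ha : a ∈ Γ.fixed H) (b : T) :
    Γ.trace H (a * b) = a * Γ.trace H b := by
  rw [trace, trace, Finset.mul_sum]
  exact Finset.sum_congr rfl fun m _ => by rw [map_mul, ha m]

/-- The coordinates form a dual basis: e t = ∑ X_i tr(Y_i t). Hence the T^H-span N of the X_i
satisfies N ≤ I N for the ideal I of traces, and Nakayama's lemma gives r ∈ 1 + I killing N, which
contains e. -/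
theorem exists_trace_eq {ι : Type*} [Fintype ι] {e : T} (he : e ∈ Γ.fixed H) (X Y : ι → T)
    (hX : ∀ i, X i * e = X i) (h1 : ∑ i, X i * Y i = e)
    (h0 : ∀ m : H, m ≠ 1 → ∑ i, X i * Γ.β m (Y i) = 0) : ∃ c, Γ.trace H c = e := by
  have dual (t : T) : ∑ i, X i * Γ.trace H (Y i * t) = e * t := by
    simp only [trace, map_mul, Finset.mul_sum]
    rw [Finset.sum_comm, Finset.sum_eq_single 1]
    · simp [← h1, Finset.sum_mul, mul_assoc]
    · intro m _ hm
      simp only [← mul_assoc]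
      rw [← Finset.sum_mul, h0 m hm, zero_mul]
    · simp
  let I : Ideal (Γ.fixed H) :=
    { carrier := {a | ∃ t, Γ.trace H t = a}
      add_mem' := by
        rintro _ _ ⟨a, ha⟩ ⟨b, hb⟩
        exact ⟨a + b, by rw [trace_add, ha, hb, Subalgebra.coe_add]⟩
      zero_mem' := ⟨0, by simp [trace]⟩
      smul_mem' := by
        rintro r _ ⟨a, ha⟩
        exact ⟨r * a, by rw [Γ.trace_mul r.2, ha, smul_eq_mul, Subalgebra.coe_mul]⟩ }
  have tr_mem (t : T) : (⟨Γ.trace H t, Γ.trace_mem_fixed t⟩ : Γ.fixed H) ∈ I := ⟨t, rfl⟩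
  let N : Submodule (Γ.fixed H) T := Submodule.span _ (Set.range X)
  have mem_smul (t : T) : e * t ∈ I • N := by
    rw [← dual]
    refine Submodule.sum_mem _ fun i _ => ?_
    rw [mul_comm]
    exact Submodule.smul_mem_smul (tr_mem (Y i * t)) (Submodule.subset_span ⟨i, rfl⟩)
  have hN : N ≤ I • N := Submodule.span_le.2 <| by
    rintro _ ⟨i, rfl⟩
    rw [← hX i, mul_comm]
    exact mem_smul (X i)
  obtain ⟨r, ⟨c, hc⟩, hr⟩ := Submodule.exists_sub_one_mem_and_smul_eq_zero_of_fg_of_le_smul I N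
    (Submodule.fg_span (Set.finite_range X)) hN
  have hre : (r : T) * e = 0 :=
    hr e (by simpa using Submodule.smul_le_right (mem_smul 1))
  rw [Subalgebra.coe_sub, Subalgebra.coe_one] at hc
  -- With r - 1 = tr(c) and r e = 0, tr(-e c) = -e (r - 1) = e.
  refine ⟨-e * c, ?_⟩
  rw [Γ.trace_mul (neg_mem he), hc]
  linear_combination -hre

end Trace

/-! ### Galois coordinates and invariants for G/H -/

variable {n : ℕ} (h : Fin (n + 1) ≃ H)

theorem idem_mul_β_φ_one (i : Fin (n + 1)) :
    Γ.idem h i * Γ.β (h i : G) (Γ.φ 1) = Γ.idem h i := by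
  rw [mul_comm, β_mul_idem]

open Classical in
-- For fixed i, conjugating g by h_i reduces the sum to the coordinates of S, with value δ_{1,g}
-- times the i-th idempotent; these idempotents add up to e_H.
theorem sum_idem_mul_β {m : ℕ} {x y : Fin m → S}
    (hxy : ∀ g : G, ∑ i, x i * α.act g (y i) = if g = 1 then 1 else 0) (g : G) :
    ∑ p : Fin (n + 1) × Fin m, Γ.idem h p.1 * Γ.β (h p.1 : G) (Γ.φ (x p.2)) *
      Γ.β g (Γ.β (h p.1 : G) (Γ.φ (y p.2))) = if g = 1 then Γ.psi h (Γ.φ 1) else 0 := by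
  have hT (g : G) : ∑ i, Γ.φ (x i) * Γ.β g (Γ.φ (y i)) = if g = 1 then Γ.φ 1 else 0 := by
    have := congrArg Γ.φ (hxy g)
    rw [map_sum, apply_ite Γ.φ, map_zero] at this
    rw [← this]
    refine Finset.sum_congr rfl fun i _ => ?_
    rw [map_mul, φ_act]
    linear_combination -(Γ.β g (Γ.φ (y i))) * Γ.φ_mul_φ_one (x i)
  have key (i : Fin (n + 1)) : ∑ j, Γ.idem h i * Γ.β (h i : G) (Γ.φ (x j)) *
      Γ.β g (Γ.β (h i : G) (Γ.φ (y j))) = if g = 1 then Γ.idem h i else 0 := by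
    have := congrArg (Γ.β (h i : G)) (hT ((h i : G)⁻¹ * g * h i))
    rw [map_sum, apply_ite (Γ.β (h i : G)), map_zero] at this
    have h1 : (h i : G)⁻¹ * g * h i = 1 ↔ g = 1 := by
      rw [mul_eq_one_iff_eq_inv, inv_mul_eq_iff_eq_mul, mul_inv_cancel]
    rw [if_congr h1 rfl rfl] at this
    calc _ = Γ.idem h i * ∑ j, Γ.β (h i : G) (Γ.φ (x j) *
          Γ.β ((h i : G)⁻¹ * g * h i) (Γ.φ (y j))) := by
          rw [Finset.mul_sum]
          refine Finset.sum_congr rfl fun j _ => ?_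
          rw [map_mul, ← β_mul_apply, ← β_mul_apply, mul_assoc]
          congr 4
          group
      _ = _ := by
          rw [this]
          split_ifs
          · exact Γ.idem_mul_β_φ_one h i
          · exact mul_zero _
  rw [Fintype.sum_prod_type, Finset.sum_congr rfl fun i _ => key i]
  split_ifs
  · rw [psi_φ_one]
  · simp

variable [H.Normal]

theorem quotientAction_exists_coordinates [Finite G]
    (hα : ∃ (m : ℕ) (x y : Fin m → S), ∀ g : G,
      (g = 1 → ∑ i, x i * α.act g (y i) = 1) ∧ (g ≠ 1 → ∑ i, x i * α.act g (y i) = 0)) :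
    ∃ (m : ℕ) (x y : Fin m → (α.restrict H).invariants), ∀ q : G ⧸ H,
      (q = 1 → ∑ i, x i * (Γ.quotientAction h).act q (y i) = 1) ∧
      (q ≠ 1 → ∑ i, x i * (Γ.quotientAction h).act q (y i) = 0) := by
  classical
  cases nonempty_fintype H
  obtain ⟨m, x, y, hxy⟩ := hα
  set e := Γ.psi h (Γ.φ 1) with he_def
  have he : e ∈ Γ.fixed H := Γ.psi_φ_one_mem_fixed h
  let X : Fin (n + 1) × Fin m → T := fun p => Γ.idem h p.1 * Γ.β (h p.1 : G) (Γ.φ (x p.2))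
  let Y : Fin (n + 1) × Fin m → T := fun p => Γ.β (h p.1 : G) (Γ.φ (y p.2))
  have hXY (g : G) : ∑ p, X p * Γ.β g (Y p) = if g = 1 then e else 0 :=
    Γ.sum_idem_mul_β h (fun g => by
      split_ifs with hg
      exacts [(hxy g).1 hg, (hxy g).2 hg]) g
  have hX (p) : X p * e = X p := by rw [mul_right_comm, idem_mul_psi]
  clear_value X Y
  obtain ⟨c, hc⟩ := Γ.exists_trace_eq he X Y hX
    (by simpa using hXY 1)
    (fun a ha => by rw [hXY, if_neg (by simpa using ha)])
  let X' : Fin (n + 1) × Fin m → T := fun p => Γ.trace H (c * X p)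
  let Y' : Fin (n + 1) × Fin m → T := fun p => Γ.trace H (Y p)
  have hX' (p) : X' p ∈ Γ.fixed H := Γ.trace_mem_fixed _
  have hY' (p) : Y' p ∈ Γ.fixed H := Γ.trace_mem_fixed _
  have hXY' (g : G) : ∑ p, X' p * Γ.β g (Y' p) = if g ∈ H then e * e else 0 := by
    -- After expanding both traces, the (a, b) term is β_a(c) β_a(∑ X_p β_{a⁻¹gb}(Y_p)), nonzero
    -- only if gb = a, which forces g ∈ H; what remains is tr(c) e.
    have key (a b : H) : ∑ p, Γ.β a (c * X p) * Γ.β g (Γ.β b (Y p)) =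
        if (g : G) * b = a then Γ.β a c * e else 0 := by
      have := congrArg (Γ.β a) (hXY ((a : G)⁻¹ * (g * b)))
      rw [map_sum, apply_ite (Γ.β (a : G)), map_zero, he a,
        if_congr (inv_mul_eq_one.trans eq_comm) rfl rfl] at this
      calc _ = Γ.β a c * ∑ p, Γ.β a (X p * Γ.β ((a : G)⁻¹ * (g * b)) (Y p)) := by
            rw [Finset.mul_sum]
            refine Finset.sum_congr rfl fun p _ => ?_
            rw [map_mul, map_mul, ← β_mul_apply, ← β_mul_apply, mul_assoc, mul_inv_cancel_left]
        _ = _ := by rw [this, mul_ite, mul_zero]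
    calc _ = ∑ b : H, ∑ a : H, ∑ p, Γ.β a (c * X p) * Γ.β g (Γ.β b (Y p)) := by
          simp only [X', Y', trace, map_sum, Finset.mul_sum, Finset.sum_mul]
          rw [Finset.sum_comm]
          refine Finset.sum_congr rfl fun b _ => Finset.sum_comm
      _ = _ := by
          simp only [key]
          rw [Finset.sum_comm]
          split_ifs with hg
          · conv_rhs => rw [← congrArg (· * e) hc]
            simp only [trace, Finset.sum_mul]
            refine Finset.sum_congr rfl fun a _ => ?_
            rw [Finset.sum_eq_single (⟨g, hg⟩⁻¹ * a)]
            · simp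
            · intro b _ hb
              refine if_neg fun hba => hb ?_
              rw [eq_inv_mul_iff_mul_eq]
              exact Subtype.ext hba
            · simp
          · refine Finset.sum_eq_zero fun a _ => Finset.sum_eq_zero fun b _ => if_neg fun hba => hg ?_
            rw [eq_mul_inv_of_mul_eq hba]
            exact mul_mem a.2 (inv_mem b.2)
  let σ := finProdFinEquiv (m := n + 1) (n := m)
  have hsum (g : G) : Γ.φ ((∑ i, (⟨Γ.proj (X' (σ.symm i)), Γ.proj_mem_invariants (hX' _)⟩ :
        (α.restrict H).invariants) * (Γ.quotientAction h).act (g : G ⧸ H)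
        ⟨Γ.proj (Y' (σ.symm i)), Γ.proj_mem_invariants (hY' _)⟩ :
        (α.restrict H).invariants) : S) =
      (if g ∈ H then e * e else 0) * (Γ.β g e * Γ.φ 1) := by
    rw [← hXY', Finset.sum_mul, ← σ.symm.sum_comp, AddSubmonoidClass.coe_finsetSum, map_sum]
    refine Finset.sum_congr rfl fun i _ => ?_
    rw [quotientAction_act, Subalgebra.coe_mul, map_mul Γ.φ, φ_quotientMap, φ_proj,
      Γ.psi_φ_proj h (hY' _), map_mul (Γ.β g)]
    linear_combination (X' (σ.symm i) * Γ.β g (Y' (σ.symm i)) * Γ.β g e) * Γ.φ_mul_φ_one 1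
  refine ⟨(n + 1) * m, fun i => ⟨Γ.proj (X' (σ.symm i)), Γ.proj_mem_invariants (hX' _)⟩,
    fun i => ⟨Γ.proj (Y' (σ.symm i)), Γ.proj_mem_invariants (hY' _)⟩, fun q => ?_⟩
  obtain ⟨g, rfl⟩ := QuotientGroup.mk_surjective q
  have hq := QuotientGroup.eq_one_iff (N := H) g
  refine ⟨fun hg => ?_, fun hg => ?_⟩ <;> refine Subtype.ext (Γ.φ_injective ?_) <;> rw [hsum]
  · have h2 : Γ.φ 1 * e = Γ.φ 1 := Γ.φ_one_mul_psi h
    rw [if_pos (hq.1 hg), show Γ.β g e = e from he ⟨g, hq.1 hg⟩, Subalgebra.coe_one]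
    -- 1_S absorbs e three times; the coefficient telescopes 1_S (e³ - 1).
    linear_combination (e * e + e + 1) * h2
  · rw [if_neg (mt hq.2 hg), zero_mul, Subalgebra.coe_zero, map_zero]

/-- With z = ψ_H(x), invariance under G/H reads β_g(z) 1_S = x β_g(e_H). Multiplying by β_g(1_S)
gives invariance under g; conversely, invariance under all gb with b ∈ H gives this equality on each
β_{gb}(1_S), and these idempotents generate β_g(e_H). -/
theorem mem_quotientAction_invariants_iff (x : (α.restrict H).invariants) :
    x ∈ (Γ.quotientAction h).invariants ↔ (x : S) ∈ α.invariants := by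
  set e := Γ.psi h (Γ.φ 1) with he_def
  set z := Γ.psi h (Γ.φ x) with hz_def
  have hz : z ∈ Γ.fixed H := Γ.psi_mem_fixed h x.2
  have hzu (m : H) : z * Γ.β m (Γ.φ 1) = Γ.β m (Γ.φ x) := Γ.psi_mul_β h x.2 m
  have hzu1 : z * Γ.φ 1 = Γ.φ x := Γ.psi_mul_φ_one h x.2
  have hue : Γ.φ 1 * e = Γ.φ 1 := Γ.φ_one_mul_psi h
  have h1 : x ∈ (Γ.quotientAction h).invariants ↔
      ∀ g : G, Γ.β g z * Γ.φ 1 = Γ.φ x * Γ.β g e := by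
    constructor
    · intro hx g
      have := congrArg (fun b : (α.restrict H).invariants => Γ.φ b) (hx (g : G ⧸ H))
      rw [quotientAction_act, quotientAction_e, φ_quotientMap, Subalgebra.coe_mul, map_mul Γ.φ,
        φ_quotientMap, Subalgebra.coe_one] at this
      rw [this]
      linear_combination Γ.β g e * Γ.φ_mul_φ_one x
    · intro hx q
      obtain ⟨g, rfl⟩ := QuotientGroup.mk_surjective q
      refine Subtype.ext (Γ.φ_injective ?_)
      rw [quotientAction_act, quotientAction_e, φ_quotientMap, Subalgebra.coe_mul, map_mul Γ.φ,
        φ_quotientMap, Subalgebra.coe_one, hx]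
      linear_combination -Γ.β g e * Γ.φ_mul_φ_one x
  have h2 : (x : S) ∈ α.invariants ↔ ∀ g : G,
      Γ.β g (Γ.φ x) * Γ.φ 1 = Γ.φ x * Γ.β g (Γ.φ 1) := by
    refine forall_congr' fun g => ?_
    rw [← Γ.φ_injective.eq_iff, map_mul, φ_act, φ_e, mul_comm (Γ.β g (Γ.φ 1)), ← mul_assoc,
      φ_mul_φ_one]
  rw [h1, h2]
  constructor
  · intro hx g
    have h3 : Γ.β g (Γ.φ 1) * Γ.β g e = Γ.β g (Γ.φ 1) := by rw [← map_mul, hue]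
    rw [← hzu1, map_mul, hzu1]
    linear_combination Γ.β g (Γ.φ 1) * hx g + Γ.φ x * h3
  · intro hx g
    have key (b : H) : Γ.β g z * Γ.φ 1 * Γ.β g (Γ.β b (Γ.φ 1)) =
        Γ.φ x * Γ.β g (Γ.β b (Γ.φ 1)) := by
      rw [mul_right_comm, ← map_mul, hzu, ← β_mul_apply, hx, ← β_mul_apply]
    have hze : z * e = z := Γ.psi_mul_psi h h _
    have hsum (t : T) : t * Γ.β g e =
        ∑ i, t * Γ.β g (Γ.β (h i : G) (Γ.φ 1)) * Γ.β g (Γ.idem h i) := by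
      rw [he_def, psi, map_sum, Finset.mul_sum]
      exact Finset.sum_congr rfl fun i _ => by rw [map_mul, mul_assoc]
    rw [hsum (Γ.φ x), Finset.sum_congr rfl fun i _ => by rw [← key], ← hsum]
    conv_lhs => rw [← hze, map_mul]
    ring

end Globalization

end UnitalPartialAction
theorem theorem3p1 {k : Type u} [CommRing k] {S : Type v} [CommRing S] [Algebra k S]
    {G : Type w} [Group G] [Finite G] (α : UnitalPartialAction k G S)
    (hα : α.IsPartialGaloisExtension α.invariants) (H : Subgroup G) [H.Normal] :
    ∃ α' : UnitalPartialAction k (G ⧸ H) (α.restrict H).invariants,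
      α.IsInducedQuotient H α' ∧
      α'.IsPartialGaloisExtension α.invariants ∧
      α'.invariants.map (α.restrict H).invariants.val = α.invariants := by
  obtain ⟨n, hn⟩ := Nat.exists_eq_succ_of_ne_zero (Nat.card_pos (α := H)).ne'
  -- Any enumeration will do: ψ_H does not depend on it on H-invariant elements.
  let h : Fin (n + 1) ≃ H := (Finite.equivFinOfCardEq hn).symm
  have hinv : (α.envelopingGlobalization.quotientAction h).invariants.map
      (α.restrict H).invariants.val = α.invariants := by
    ext s
    rw [Subalgebra.mem_map]
    constructor
    · rintro ⟨x, hx, rfl⟩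
      exact (UnitalPartialAction.Globalization.mem_quotientAction_invariants_iff _ h x).1 hx
    · exact fun hs => ⟨⟨s, fun m => hs m⟩,
        (UnitalPartialAction.Globalization.mem_quotientAction_invariants_iff _ h _).2 hs, rfl⟩
  refine ⟨α.envelopingGlobalization.quotientAction h,
    UnitalPartialAction.isInducedQuotient_quotientAction H h, ⟨⟨?_⟩, ?_⟩, hinv⟩
  · exact (((α.envelopingGlobalization.quotientAction h).invariants.equivMapOfInjective
      (α.restrict H).invariants.val Subtype.val_injective).trans
      (Subalgebra.equivOfEq _ _ hinv)).symm
  · obtain ⟨m, x, y, hxy⟩ := hα.2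
    obtain ⟨m', x', y', hxy'⟩ := α.envelopingGlobalization.quotientAction_exists_coordinates h
      ⟨m, x, y, fun g => ⟨fun hg => by rw [hxy, if_pos hg], fun hg => by rw [hxy, if_neg hg]⟩⟩
    refine ⟨m', x', y', fun q => ?_⟩
    split_ifs with hq
    exacts [(hxy' q).1 hq, (hxy' q).2 hq]
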